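/- Let $(\mathcal M,g,A)$ be a Kähler manifold of real dimension $n=2k\ge 4$: a smooth Riemannian manifold with a smooth $(1,1)$-tensor field $A$ such that $A^2=-I$, $g(AX,AY)=g(X,Y)$ and $\nabla A=0$, where $\nabla$ is the Levi-Civita connection. Let $\pi$ be a smooth 1-form and let $\overset{1}{\nabla}$ be the quarter-symmetric connection $$\overset{1}{\nabla}_XY=\nabla_XY-\pi(X)AY .$$ Put $\overset{2}{\nabla}_XY=\overset{1}{\nabla}_YX+[X,Y]$ and $\overset{0}{\nabla}=\tfrac12(\overset{1}{\nabla}+\overset{2}{\nabla})$. Let $R$ be the curvature tensor of $\nabla$ and, for $\theta=0,1,2$, let $\overset{\theta}{R}$ be that of $\overset{\theta}{\nabla}$, that is $\overset{\theta}{R}(X,Y)Z=\overset{\theta}{\nabla}_X\overset{\theta}{\nabla}_YZ-\overset{\theta}{\nabla}_Y\overset{\theta}{\nabla}_XZ-\overset{\theta}{\nabla}_{[X,Y]}Z$; let $$\overset{3}{R}(X,Y)Z=\overset{2}{\nabla}_X\overset{1}{\nabla}_YZ-\overset{1}{\nabla}_Y\overset{2}{\nabla}_XZ+\overset{2}{\nabla}_{\overset{1}{\nabla}_YX}Z-\overset{1}{\nabla}_{\overset{2}{\nabla}_XY}Z,$$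 $$\overset{5}{R}(X,Y)Z=\tfrac12\big(\overset{1}{\nabla}_X\overset{1}{\nabla}_YZ-\overset{2}{\nabla}_Y\overset{1}{\nabla}_XZ+\overset{2}{\nabla}_X\overset{2}{\nabla}_YZ-\overset{1}{\nabla}_Y\overset{2}{\nabla}_XZ-\overset{1}{\nabla}_{[X,Y]}Z-\overset{2}{\nabla}_{[X,Y]}Z\big).$$ Write $\overset{\theta}{Ric}(Y,Z)=\mathrm{Trace}\{X\mapsto\overset{\theta}{R}(X,Y)Z\}$, $Ric(Y,Z)=\mathrm{Trace}\{X\mapsto R(X,Y)Z\}$ and $\overset{3}{{}'R}(X,Y)=\mathrm{Trace}\{Z\mapsto\overset{3}{R}(X,Y)Z\}$, and define $$\overset{1}{H}(X,Y)Z=\overset{1}{R}(X,Y)Z+\overset{1}{Ric}(Y,AX)AZ,$$ $$\overset{2}{H}(X,Y)Z=\overset{2}{R}(X,Y)Z+\overset{2}{Ric}(AX,Z)AY-\overset{2}{Ric}(AY,Z)AX,$$ $$\begin{aligned}\overset{0}{H}(X,Y)Z={}&\overset{0}{R}(X,Y)Z+\tfrac1{n-1}\big(\overset{0}{Ric}(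X,Z)Y-\overset{0}{Ric}(Y,Z)X\big)-\tfrac1{2(n-1)}\big(\overset{1}{Ric}(X,Z)Y-\overset{1}{Ric}(Y,Z)X\big)\\&-\tfrac1{4(n-1)}\big(\overset{3}{Ric}(Z,X)Y-\overset{3}{Ric}(Z,Y)X+\overset{3}{{}'R}(AZ,AX)Y-\overset{3}{{}'R}(AZ,AY)X\big)\\&+\tfrac14\big(2\overset{1}{Ric}(Y,AX)AZ+\overset{3}{Ric}(Z,AX)AY-\overset{3}{Ric}(Z,AY)AX\big)-\tfrac14\big(\overset{3}{{}'R}(AZ,X)AY-\overset{3}{{}'R}(AZ,Y)AX\big),\end{aligned}$$ $$\begin{aligned}\overset{5}{H}(X,Y)Z={}&\overset{5}{R}(X,Y)Z+\tfrac1{n-1}\big(\overset{5}{Ric}(X,Y)Z-\overset{5}{Ric}(Y,Z)X\big)-\tfrac1{2(n-1)}\big(\overset{1}{Ric}(X,Y)Z-\overset{1}{Ric}(Y,Z)X\big)\\&-\tfrac1{2(n-1)}\big(\overset{3}{{}'R}(AY,AX)Z-\overset{3}{{}'R}(AZ,AY)X\big)+\tfrac12\big(\overset{1}{Ric}(Y,AX)AZ-\overset{3}{Ric}(Z,AY)AX-\overset{3}{{}'R}(AZ,X)AY\big).\end{aligned}$$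 Let $W(X,Y)Z=R(X,Y)Z+\tfrac1{n-1}\big(Ric(X,Z)Y-Ric(Y,Z)X\big)$ be the Weyl projective curvature tensor of $g$. Then, for all smooth vector fields $X,Y,Z$, $$4\overset{0}{H}(X,Y)Z-2\overset{1}{H}(X,Y)Z-\overset{2}{H}(X,Y)Z=W(X,Y)Z,$$ $$2\overset{5}{H}(X,Y)Z-\overset{1}{H}(X,Y)Z+\overset{1}{H}(Y,Z)X=W(X,Z)Y.$$ -/

import Mathlib

open Bundle Module VectorField
open scoped Manifold ContDiff

namespace QuarterSymmetric

noncomputable section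

variable {E : Type*} [NormedAddCommGroup E] [NormedSpace ℝ E] [FiniteDimensional ℝ E]
  {M : Type*} [TopologicalSpace M] [ChartedSpace E M] [IsManifold 𝓘(ℝ, E) ∞ M]

/-! ### Vector fields, one-forms, endomorphism fields, connections

The manifold `M` is boundaryless and modelled on the finite-dimensional real space `E`, so that
its dimension is `finrank ℝ E`. -/

instance (x : M) : FiniteDimensional ℝ (TangentSpace 𝓘(ℝ, E) x) :=
  inferInstanceAs (FiniteDimensional ℝ E)

instance (x : M) : T2Space (TangentSpace 𝓘(ℝ, E) x) :=
  inferInstanceAs (T2Space E)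

variable (E M) in
/-- Vector fields on `M` (without regularity). -/
abbrev VField : Type _ := Π x : M, TangentSpace 𝓘(ℝ, E) x

variable (E M) in
/-- One-forms on `M` (without regularity). -/
abbrev OneForm : Type _ := Π x : M, TangentSpace 𝓘(ℝ, E) x →L[ℝ] ℝ

variable (E M) in
/-- Fields of endomorphisms of the tangent spaces, i.e. `(1,1)`-tensors (without regularity). -/
abbrev EndField : Type _ := Π x : M, TangentSpace 𝓘(ℝ, E) x →L[ℝ] TangentSpace 𝓘(ℝ, E) x

variable (E M) in
/-- Linear connections on `M`; `D Y x (X x)` is the value of `∇_X Y` at `x`. -/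
abbrev Connection : Type _ :=
  CovariantDerivative 𝓘(ℝ, E) E (TangentSpace 𝓘(ℝ, E) : M → Type _)

/-- A `C^∞` vector field. -/
def SmoothField (X : VField E M) : Prop :=
  ContMDiff 𝓘(ℝ, E) (𝓘(ℝ, E).prod 𝓘(ℝ, E)) ∞
    (fun x ↦ TotalSpace.mk' E (E := (TangentSpace 𝓘(ℝ, E) : M → Type _)) x (X x))

/-- A `C^∞` one-form. -/
def SmoothOneForm (η : OneForm E M) : Prop :=
  ContMDiff 𝓘(ℝ, E) (𝓘(ℝ, E).prod 𝓘(ℝ, E →L[ℝ] ℝ)) ∞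
    (fun x ↦ TotalSpace.mk' (E →L[ℝ] ℝ)
      (E := fun x : M ↦ (TangentSpace 𝓘(ℝ, E) x →L[ℝ] ℝ)) x (η x))

/-- A `C^∞` field of endomorphisms. -/
def SmoothEndField (A : EndField E M) : Prop :=
  ContMDiff 𝓘(ℝ, E) (𝓘(ℝ, E).prod 𝓘(ℝ, E →L[ℝ] E)) ∞
    (fun x ↦ TotalSpace.mk' (E →L[ℝ] E)
      (E := fun x : M ↦ (TangentSpace 𝓘(ℝ, E) x →L[ℝ] TangentSpace 𝓘(ℝ, E) x)) x (A x))

/-- The vector field `A X`. -/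
def EndField.app (A : EndField E M) (X : VField E M) : VField E M := fun x ↦ A x (X x)

/-- The vector field `∇_X Y`. -/
def cov (D : Connection E M) (X Y : VField E M) : VField E M := fun x ↦ D Y x (X x)

/-! ### Kähler manifolds -/

section Kahler

variable [RiemannianBundle (fun x : M ↦ TangentSpace 𝓘(ℝ, E) x)]
  [IsContMDiffRiemannianBundle 𝓘(ℝ, E) ∞ E (fun x : M ↦ TangentSpace 𝓘(ℝ, E) x)]

/-- `D` is the Levi-Civita connection of the Riemannian metric of `M`: a smooth linear connection
that is metric and torsion-free. -/
structure IsLeviCivita (D : Connection E M) : Prop where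
  smooth : CovariantDerivative.ContMDiffCovariantDerivative D ∞
  metric : CovariantDerivative.IsMetricCompatible (V := fun x : M ↦ TangentSpace 𝓘(ℝ, E) x) D
  torsion_free : D.torsion = 0

/-- `A` is an almost complex structure that is compatible with the Riemannian metric of `M`. -/
structure IsAlmostHermitian (A : EndField E M) : Prop where
  smooth : SmoothEndField A
  sq : ∀ (x : M) (v : TangentSpace 𝓘(ℝ, E) x), A x (A x v) = -v
  isometry : ∀ (x : M) (v w : TangentSpace 𝓘(ℝ, E) x), inner ℝ (A x v) (A x w) = inner ℝ v w

/-- `M` with its Riemannian metric, the Levi-Civita connection `D` of that metric and the tensor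
field `A` is a Kähler manifold: `A` is almost Hermitian and parallel, `∇_v (A Y) = A (∇_v Y)`. -/
structure IsKahler (D : Connection E M) (A : EndField E M) : Prop where
  leviCivita : IsLeviCivita D
  almostHermitian : IsAlmostHermitian A
  parallel : ∀ (Y : VField E M) (x : M),
    MDifferentiableAt 𝓘(ℝ, E) (𝓘(ℝ, E).prod 𝓘(ℝ, E))
      (fun y ↦ TotalSpace.mk' E (E := (TangentSpace 𝓘(ℝ, E) : M → Type _)) y (Y y)) x →
    ∀ v : TangentSpace 𝓘(ℝ, E) x, D (A.app Y) x v = A x (D Y x v)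

end Kahler

/-! ### The quarter-symmetric connection and its companions -/

/-- The `Hom(TM, TM)`-valued one-form `Y ↦ (X ↦ -η(X) A Y)` at the point `x`. -/
def quarterSymmetricForm (A : EndField E M) (η : OneForm E M) (x : M) :
    TangentSpace 𝓘(ℝ, E) x →L[ℝ] TangentSpace 𝓘(ℝ, E) x →L[ℝ] TangentSpace 𝓘(ℝ, E) x :=
  LinearMap.toContinuousLinearMap
    { toFun := fun v ↦ -(η x).smulRight (A x v)
      map_add' := fun v w ↦ by ext u; simp; abel
      map_smul' := fun c v ↦ by ext u; simp [smul_comm c] }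

/-- The quarter-symmetric connection `∇¹` with generator `η`: `∇¹_X Y = ∇_X Y - η(X) A Y`. -/
def quarterSymmetric (D : Connection E M) (A : EndField E M) (η : OneForm E M) :
    Connection E M :=
  D.addOneForm (quarterSymmetricForm A η)

/-- The conjugate `∇²` of a connection `∇¹` with torsion `T¹`:
`∇²_X Y = ∇¹_X Y - T¹(X, Y)`, i.e. `∇²_X Y = ∇¹_Y X + [X, Y]`
(written with `T¹(Y, X) = -T¹(X, Y)`). -/
def conj (D₁ : Connection E M) : Connection E M :=
  D₁.addOneForm D₁.torsion

/-- The symmetric part `∇⁰ = (∇¹ + ∇²) / 2` of a connection `∇¹`. -/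
def symmPart (D₁ : Connection E M) : Connection E M :=
  D₁.affineCombination (conj D₁) (fun _ ↦ 1 / 2)

/-! ### Curvature tensors -/

/-- `R(X,Y)Z = ∇_X ∇_Y Z - ∇_Y ∇_X Z - ∇_{[X,Y]} Z`. -/
def curv (D : Connection E M) (X Y Z : VField E M) : VField E M :=
  cov D X (cov D Y Z) - cov D Y (cov D X Z) - cov D (mlieBracket 𝓘(ℝ, E) X Y) Z

/-- Curvature tensor of kind zero of `∇¹`: the curvature tensor of `∇⁰`. -/
def curv0 (D₁ : Connection E M) (X Y Z : VField E M) : VField E M := curv (symmPart D₁) X Y Z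

/-- Curvature tensor of the first kind of `∇¹`. -/
def curv1 (D₁ : Connection E M) (X Y Z : VField E M) : VField E M := curv D₁ X Y Z

/-- Curvature tensor of the second kind of `∇¹`: the curvature tensor of `∇²`. -/
def curv2 (D₁ : Connection E M) (X Y Z : VField E M) : VField E M := curv (conj D₁) X Y Z

/-- Curvature tensor of the third kind of `∇¹`:
`R³(X,Y)Z = ∇²_X ∇¹_Y Z - ∇¹_Y ∇²_X Z + ∇²_{∇¹_Y X} Z - ∇¹_{∇²_X Y} Z`. -/
def curv3 (D₁ : Connection E M) (X Y Z : VField E M) : VField E M :=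
  let D₂ := conj D₁
  cov D₂ X (cov D₁ Y Z) - cov D₁ Y (cov D₂ X Z) + cov D₂ (cov D₁ Y X) Z - cov D₁ (cov D₂ X Y) Z

/-- Curvature tensor of the fifth kind of `∇¹`:
`R⁵(X,Y)Z = (∇¹_X ∇¹_Y Z - ∇²_Y ∇¹_X Z + ∇²_X ∇²_Y Z - ∇¹_Y ∇²_X Z
  - ∇¹_{[X,Y]} Z - ∇²_{[X,Y]} Z) / 2`. -/
def curv5 (D₁ : Connection E M) (X Y Z : VField E M) : VField E M :=
  let D₂ := conj D₁
  (1 / 2 : ℝ) • (cov D₁ X (cov D₁ Y Z) - cov D₂ Y (cov D₁ X Z)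
    + cov D₂ X (cov D₂ Y Z) - cov D₁ Y (cov D₂ X Z)
    - cov D₁ (mlieBracket 𝓘(ℝ, E) X Y) Z - cov D₂ (mlieBracket 𝓘(ℝ, E) X Y) Z)

/-! ### Traces and Ricci tensors -/

/-- The trace at `x` of an operator `Φ` on vector fields, computed in a basis `b` of `T_x M`. The
basis vector `b i` is extended to a vector field that is smooth near `x` (with constant
coefficients in the preferred chart at `x`). If `Φ` is tensorial this is the trace of the
endomorphism that `Φ` induces on `T_x M`, see `trace_eq`. -/
def trace (Φ : VField E M → VField E M) (x : M) : ℝ :=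
  let b := finBasis ℝ (TangentSpace 𝓘(ℝ, E) x)
  ∑ i, b.coord i (Φ (FiberBundle.extend E (b i)) x)

/-- If `Φ` acts at `x` on the extended vectors through a linear map `L`, then its trace is that
of `L`. -/
theorem trace_eq (Φ : VField E M → VField E M) (x : M)
    (L : TangentSpace 𝓘(ℝ, E) x →ₗ[ℝ] TangentSpace 𝓘(ℝ, E) x)
    (h : ∀ v : TangentSpace 𝓘(ℝ, E) x, Φ (FiberBundle.extend E v) x = L v) :
    trace Φ x = LinearMap.trace ℝ _ L := by
  rw [LinearMap.trace_eq_matrix_trace ℝ (finBasis ℝ (TangentSpace 𝓘(ℝ, E) x))]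
  simp [trace, h, Matrix.trace, LinearMap.toMatrix_apply]

/-- `Ric(Y,Z) = Trace {X ↦ R(X,Y)Z}`. -/
def ric (R : VField E M → VField E M → VField E M → VField E M) (Y Z : VField E M) : M → ℝ :=
  trace fun X ↦ R X Y Z

/-- `'R(X,Y) = Trace {Z ↦ R(X,Y)Z}`. -/
def primeTrace (R : VField E M → VField E M → VField E M → VField E M) (X Y : VField E M) :
    M → ℝ :=
  trace fun Z ↦ R X Y Z

/-! ### The Weyl projective curvature tensor and the tensors `H⁰, H¹, H², H⁵`

Here `D` is the Levi-Civita connection, `D₁` the quarter-symmetric connection, and `n` is the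
dimension of `M`. -/

/-- The Weyl projective curvature tensor,
`W(X,Y)Z = R(X,Y)Z + (Ric(X,Z)Y - Ric(Y,Z)X) / (n-1)`. -/
def weyl (D : Connection E M) (X Y Z : VField E M) : VField E M :=
  let n : ℝ := finrank ℝ E
  let Ric := ric (curv D)
  curv D X Y Z + (1 / (n - 1)) • (Ric X Z • Y - Ric Y Z • X)

/-- `H¹(X,Y)Z = R¹(X,Y)Z + Ric¹(Y,AX)AZ`. -/
def H1 (D₁ : Connection E M) (A : EndField E M) (X Y Z : VField E M) : VField E M :=
  let Ric1 := ric (curv1 D₁)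
  curv1 D₁ X Y Z + Ric1 Y (A.app X) • A.app Z

/-- `H²(X,Y)Z = R²(X,Y)Z + Ric²(AX,Z)AY - Ric²(AY,Z)AX`. -/
def H2 (D₁ : Connection E M) (A : EndField E M) (X Y Z : VField E M) : VField E M :=
  let Ric2 := ric (curv2 D₁)
  curv2 D₁ X Y Z + Ric2 (A.app X) Z • A.app Y - Ric2 (A.app Y) Z • A.app X

/-- The tensor `H⁰`. -/
def H0 (D₁ : Connection E M) (A : EndField E M) (X Y Z : VField E M) : VField E M :=
  let n : ℝ := finrank ℝ E
  let Ric0 := ric (curv0 D₁)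
  let Ric1 := ric (curv1 D₁)
  let Ric3 := ric (curv3 D₁)
  let R3' := primeTrace (curv3 D₁)
  curv0 D₁ X Y Z
    + (1 / (n - 1)) • (Ric0 X Z • Y - Ric0 Y Z • X)
    - (1 / (2 * (n - 1))) • (Ric1 X Z • Y - Ric1 Y Z • X)
    - (1 / (4 * (n - 1))) • (Ric3 Z X • Y - Ric3 Z Y • X
        + R3' (A.app Z) (A.app X) • Y - R3' (A.app Z) (A.app Y) • X)
    + (1 / 4 : ℝ) • ((2 : ℝ) • Ric1 Y (A.app X) • A.app Z
        + Ric3 Z (A.app X) • A.app Y - Ric3 Z (A.app Y) • A.app X)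
    - (1 / 4 : ℝ) • (R3' (A.app Z) X • A.app Y - R3' (A.app Z) Y • A.app X)

/-- The tensor `H⁵`. -/
def H5 (D₁ : Connection E M) (A : EndField E M) (X Y Z : VField E M) : VField E M :=
  let n : ℝ := finrank ℝ E
  let Ric1 := ric (curv1 D₁)
  let Ric3 := ric (curv3 D₁)
  let Ric5 := ric (curv5 D₁)
  let R3' := primeTrace (curv3 D₁)
  curv5 D₁ X Y Z
    + (1 / (n - 1)) • (Ric5 X Y • Z - Ric5 Y Z • X)
    - (1 / (2 * (n - 1))) • (Ric1 X Y • Z - Ric1 Y Z • X)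
    - (1 / (2 * (n - 1))) • (R3' (A.app Y) (A.app X) • Z - R3' (A.app Z) (A.app Y) • X)
    + (1 / 2 : ℝ) • (Ric1 Y (A.app X) • A.app Z - Ric3 Z (A.app Y) • A.app X
        - R3' (A.app Z) X • A.app Y)

end

end QuarterSymmetric

/-! Write `∇` for the Levi-Civita connection. Torsion-freeness gives `∇¹_X Y = ∇_X Y - η(X) AY` and
`∇²_X Y = ∇_X Y - η(Y) AX`. Since `∇A = 0` and `A² = -I`, each curvature tensor is `R` plus explicit
terms in `∇η`, `η`, `A` (`curv1_apply` to `four_smul_curv0_apply`). As functions of the traced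
argument these terms are rank-one operators `φ ⊗ w`, of trace `φ(w)`, multiples of `A`, of trace
zero because `A` is skew, or multiples of the identity. This yields the Ricci tensors and `'R³`. The
correction terms in each `H` are chosen so that everything containing `η` cancels, leaving only `R`,
`Ric` and `A` (`H1_apply`, `H2_apply`, `four_smul_H0_apply`, `two_smul_H5_apply`). In `4H⁰ - 2H¹ -
H²` the terms with `A` then cancel and `W` remains. In the second identity, the Bianchi identity
turns `R(X,Y)Z + R(Y,Z)X` into `R(X,Z)Y`. Symmetry of `Ric` serves both; it follows from Bianchi and
the vanishing of the trace of `Z ↦ R(X,Y)Z`. Tensoriality of the curvatures is never needed: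
`mul_trace_eq` compares traces of operators whose difference is linear at the point. The traces use
extended vectors that are smooth only near the point, hence the calculus of `SmoothNear` fields. -/

set_option linter.unusedSectionVars false

namespace QuarterSymmetric

open Filter Topology FiberBundle

/-! ### Fields smooth near a point, and locality of connections. -/

section Connections

variable {E : Type*} [NormedAddCommGroup E] [NormedSpace ℝ E]
  {M : Type*} [TopologicalSpace M] [ChartedSpace E M]

/-- A vector field that is `C^∞` on a neighbourhood of `x`. -/
def SmoothNear [IsManifold 𝓘(ℝ, E) ∞ M] (X : VField E M) (x : M) : Prop :=
  ∀ᶠ y in 𝓝 x, CMDiffAt ∞ (T% X) y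

variable [IsManifold 𝓘(ℝ, E) ∞ M] {X Y Z : VField E M} {x : M}

theorem SmoothField.smoothNear (hX : SmoothField X) (x : M) : SmoothNear X x :=
  Eventually.of_forall fun y ↦ hX y

theorem SmoothNear.contMDiffAt (hX : SmoothNear X x) : CMDiffAt ∞ (T% X) x :=
  hX.self_of_nhds

theorem SmoothNear.mdifferentiableAt (hX : SmoothNear X x) : MDiffAt (T% X) x :=
  hX.contMDiffAt.mdifferentiableAt (by simp)

theorem SmoothNear.eventually (hX : SmoothNear X x) : ∀ᶠ y in 𝓝 x, SmoothNear X y :=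
  eventually_eventually_nhds.2 hX

theorem SmoothNear.congr (hX : SmoothNear X x) (h : ∀ᶠ y in 𝓝 x, Y y = X y) :
    SmoothNear Y x := by
  filter_upwards [hX, eventually_eventually_nhds.2 h] with y hy h
  refine hy.congr_of_eventuallyEq ?_
  filter_upwards [h] with z hz
  simp [hz]

theorem SmoothNear.add (hX : SmoothNear X x) (hY : SmoothNear Y x) : SmoothNear (X + Y) x := by
  filter_upwards [hX, hY] with y hX hY using hX.add_section hY

theorem SmoothNear.sub (hX : SmoothNear X x) (hY : SmoothNear Y x) : SmoothNear (X - Y) x := by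
  filter_upwards [hX, hY] with y hX hY using hX.sub_section hY

theorem SmoothNear.smul {f : M → ℝ} (hf : ∀ᶠ y in 𝓝 x, CMDiffAt ∞ f y) (hX : SmoothNear X x) :
    SmoothNear (f • X) x := by
  filter_upwards [hf, hX] with y hf hX using hf.smul_section hX

theorem SmoothNear.app {A : EndField E M} (hA : SmoothEndField A) (hX : SmoothNear X x) :
    SmoothNear (A.app X) x := by
  filter_upwards [hX] with y hX using (hA y).clm_bundle_apply hX

theorem SmoothNear.oneForm_apply {η : OneForm E M} (hη : SmoothOneForm η) (hX : SmoothNear X x) :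
    ∀ᶠ y in 𝓝 x, CMDiffAt ∞ (fun y ↦ η y (X y)) y := by
  filter_upwards [hX] with y hX
  have := ContMDiffAt.clm_bundle_apply (F₂ := ℝ) (E₂ := Trivial M ℝ) (b := fun y : M ↦ y)
    (ϕ := η) (hη y) hX
  exact ((contMDiffAt_section _ ).1 this)

theorem smoothNear_extend (v : TangentSpace 𝓘(ℝ, E) x) :
    SmoothNear (FiberBundle.extend E v) x := by
  obtain ⟨s, hs, h⟩ := FiberBundle.exists_contMDiffOn_extend (k := ∞) 𝓘(ℝ, E) E v
  filter_upwards [eventually_mem_nhds_iff.2 hs] with y hy using h.contMDiffAt hy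

/-- A vector field that is smooth near `x` agrees near `x` with a smooth vector field. -/
theorem SmoothNear.exists_smoothField [FiniteDimensional ℝ E] [T2Space M] (hX : SmoothNear X x) :
    ∃ X' : VField E M, SmoothField X' ∧ ∀ᶠ y in 𝓝 x, X' y = X y := by
  -- The bump function has its closed support inside the set where `X` is smooth, so `f • X` is
  -- smooth there and vanishes near every other point.
  obtain ⟨f, -, hf⟩ := (SmoothBumpFunction.nhds_basis_tsupport (I := 𝓘(ℝ, E)) x).mem_iff.1 hX
  refine ⟨(f : M → ℝ) • X, fun y ↦ ?_, ?_⟩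
  · by_cases hy : y ∈ tsupport f
    · exact (f.contMDiff y).smul_section (hf hy)
    · have h0 : (f : M → ℝ) =ᶠ[𝓝 y] 0 := notMem_tsupport_iff_eventuallyEq.1 hy
      refine (contMDiff_zeroSection ℝ (TangentSpace 𝓘(ℝ, E) : M → Type _) y).congr_of_eventuallyEq ?_
      filter_upwards [h0] with z hz
      simp [hz, zeroSection]
  · filter_upwards [f.eventuallyEq_one] with y hy
    simp [hy]

/-- A connection is local. -/
theorem Connection.congr (D : Connection E M) (hX : SmoothNear X x) (h : ∀ᶠ y in 𝓝 x, Y y = X y) :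
    D Y x = D X x :=
  D.isCovariantDerivativeOnUniv.congr_of_eventuallyEq (hX.congr h).mdifferentiableAt
    hX.mdifferentiableAt univ_mem h

/-- Smoothness of `D` is applied to a globally smooth field `Y'` that agrees with `Y` near the
point; locality of `D` carries the result back to `Y`. -/
theorem SmoothNear.cov [FiniteDimensional ℝ E] [T2Space M] {D : Connection E M}
    (hD : CovariantDerivative.ContMDiffCovariantDerivative D ∞)
    (hX : SmoothNear X x) (hY : SmoothNear Y x) : SmoothNear (cov D X Y) x := by
  obtain ⟨Y', hY', h⟩ := hY.exists_smoothField
  have hDY' := contMDiffOn_univ.1 (hD.contMDiff.contMDiff (σ := Y') (by simpa using hY'.contMDiffOn))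
  refine SmoothNear.congr (X := QuarterSymmetric.cov D X Y') ?_ ?_
  · filter_upwards [hX] with y hX using (hDY' y).clm_bundle_apply hX
  · filter_upwards [hY.eventually, eventually_eventually_nhds.2 h] with y hY h
    simp [QuarterSymmetric.cov, D.congr hY h]

/-! ### The calculus of a connection -/

theorem cov_add_apply (D : Connection E M) (hY : SmoothNear Y x) (hZ : SmoothNear Z x) :
    cov D X (Y + Z) x = cov D X Y x + cov D X Z x := by
  simp [cov, D.isCovariantDerivativeOnUniv.add hY.mdifferentiableAt hZ.mdifferentiableAt]

theorem cov_smul_apply (D : Connection E M) {f : M → ℝ} (hf : MDiffAt f x)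
    (hY : SmoothNear Y x) :
    cov D X (f • Y) x = d% f x (X x) • Y x + f x • cov D X Y x := by
  simp [cov, D.isCovariantDerivativeOnUniv.leibniz hY.mdifferentiableAt hf, add_comm]

theorem cov_const_smul_apply (D : Connection E M) (c : ℝ) (hY : SmoothNear Y x) :
    cov D X (c • Y) x = c • cov D X Y x := by
  simp [cov, D.isCovariantDerivativeOnUniv.smul_const c hY.mdifferentiableAt]

theorem cov_neg_apply (D : Connection E M) (hY : SmoothNear Y x) :
    cov D X (-Y) x = -cov D X Y x := by
  simpa using cov_const_smul_apply (X := X) D (-1) hY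

theorem SmoothNear.neg (hY : SmoothNear Y x) : SmoothNear (-Y) x := by
  filter_upwards [hY] with y hY using hY.neg_section

theorem cov_sub_apply (D : Connection E M) (hY : SmoothNear Y x) (hZ : SmoothNear Z x) :
    cov D X (Y - Z) x = cov D X Y x - cov D X Z x := by
  rw [sub_eq_add_neg, cov_add_apply D hY hZ.neg, cov_neg_apply D hZ, sub_eq_add_neg]

theorem cov_sub_smul_apply (D : Connection E M) {f : M → ℝ} (hf : ∀ᶠ y in 𝓝 x, CMDiffAt ∞ f y)
    (hY : SmoothNear Y x) (hZ : SmoothNear Z x) :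
    cov D X (Y - f • Z) x = cov D X Y x - (d% f x (X x) • Z x + f x • cov D X Z x) := by
  rw [cov_sub_apply D hY (hZ.smul hf),
    cov_smul_apply D (hf.self_of_nhds.mdifferentiableAt (by simp)) hZ]

theorem cov_congr (D : Connection E M) (hY : SmoothNear Y x) (h : ∀ᶠ y in 𝓝 x, Z y = Y y) :
    cov D X Z x = cov D X Y x := by
  simp [cov, D.congr hY h]

/-! ### Lie brackets: torsion-freeness, Jacobi identity, action on functions. -/

section FiniteDimensional

variable [FiniteDimensional ℝ E]

theorem mlieBracket_eq_cov_sub_cov {D : Connection E M} (hD : D.torsion = 0)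
    (hX : SmoothNear X x) (hY : SmoothNear Y x) :
    mlieBracket 𝓘(ℝ, E) X Y x = cov D X Y x - cov D Y X x :=
  (D.torsion_eq_zero_iff.1 hD hX.mdifferentiableAt hY.mdifferentiableAt).symm

theorem eventually_mlieBracket_eq {D : Connection E M} (hD : D.torsion = 0)
    (hX : SmoothNear X x) (hY : SmoothNear Y x) :
    ∀ᶠ y in 𝓝 x, mlieBracket 𝓘(ℝ, E) X Y y = (cov D X Y - cov D Y X) y := by
  filter_upwards [hX.eventually, hY.eventually] with y hX hY using
    mlieBracket_eq_cov_sub_cov hD hX hY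

theorem isManifold_minSmoothness_two : IsManifold 𝓘(ℝ, E) (minSmoothness ℝ 2) M := by
  rw [minSmoothness_of_isRCLikeNormedField]
  infer_instance

theorem SmoothNear.mlieBracket (hX : SmoothNear X x) (hY : SmoothNear Y x) :
    SmoothNear (mlieBracket 𝓘(ℝ, E) X Y) x := by
  have : IsManifold 𝓘(ℝ, E) ((⊤ : ℕ∞) + 1) M := inferInstanceAs (IsManifold 𝓘(ℝ, E) ∞ M)
  have : IsManifold 𝓘(ℝ, E) (minSmoothness ℝ 2) M := isManifold_minSmoothness_two
  filter_upwards [hX, hY] with y hX hY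
  exact ContMDiffAt.mlieBracket_vectorField (n := ⊤) (m := ⊤) hX hY (by simp)

theorem jacobi (hX : SmoothNear X x) (hY : SmoothNear Y x) (hZ : SmoothNear Z x) :
    mlieBracket 𝓘(ℝ, E) X (mlieBracket 𝓘(ℝ, E) Y Z) x =
      mlieBracket 𝓘(ℝ, E) (mlieBracket 𝓘(ℝ, E) X Y) Z x +
        mlieBracket 𝓘(ℝ, E) Y (mlieBracket 𝓘(ℝ, E) X Z) x := by
  have : IsManifold 𝓘(ℝ, E) (minSmoothness ℝ 3) M := by
    simpa using IsManifold.of_le (I := 𝓘(ℝ, E)) (M := M) (m := 3) (n := ∞)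
      (WithTop.coe_le_coe.2 (le_top : (3 : ℕ∞) ≤ ⊤))
  have h2 : minSmoothness ℝ 2 ≤ ∞ := by
    simpa using WithTop.coe_le_coe.2 (le_top : (2 : ℕ∞) ≤ ⊤)
  exact leibniz_identity_mlieBracket_apply (hX.contMDiffAt.of_le h2) (hY.contMDiffAt.of_le h2)
    (hZ.contMDiffAt.of_le h2)

/-- The Lie bracket acts on functions as the commutator of derivations. -/
theorem mvfderiv_mlieBracket {f : M → ℝ} (hf : ∀ᶠ y in 𝓝 x, CMDiffAt ∞ f y)
    (hX : SmoothNear X x) (hY : SmoothNear Y x)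
    (hfX : ∀ᶠ y in 𝓝 x, CMDiffAt ∞ (fun y ↦ d% f y (X y)) y)
    (hfY : ∀ᶠ y in 𝓝 x, CMDiffAt ∞ (fun y ↦ d% f y (Y y)) y) :
    d% f x (mlieBracket 𝓘(ℝ, E) X Y x) =
      d% (fun y ↦ d% f y (Y y)) x (X x) - d% (fun y ↦ d% f y (X y)) x (Y x) := by
  have : IsManifold 𝓘(ℝ, E) (minSmoothness ℝ 2) M := isManifold_minSmoothness_two
  -- The argument below needs a nonzero tangent vector; on a zero tangent space both sides vanish.
  by_cases hE : Subsingleton (TangentSpace 𝓘(ℝ, E) x)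
  · simp [Subsingleton.elim (mlieBracket 𝓘(ℝ, E) X Y x) 0, Subsingleton.elim (X x) 0,
      Subsingleton.elim (Y x) 0]
  rw [not_subsingleton_iff_nontrivial] at hE
  obtain ⟨v, hv⟩ := exists_ne (0 : TangentSpace 𝓘(ℝ, E) x)
  let Z : VField E M := FiberBundle.extend E v
  have hZ : SmoothNear Z x := smoothNear_extend v
  have hmd {g : M → ℝ} {y : M} (hg : CMDiffAt ∞ g y) : MDiffAt g y :=
    hg.mdifferentiableAt (by simp)
  have key {X Y : VField E M} (hY : SmoothNear Y x)
      (hfY : ∀ᶠ y in 𝓝 x, CMDiffAt ∞ (fun y ↦ d% f y (Y y)) y) :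
      mlieBracket 𝓘(ℝ, E) X (mlieBracket 𝓘(ℝ, E) Y (f • Z)) x =
        d% (fun y ↦ d% f y (Y y)) x (X x) • Z x
          + d% f x (Y x) • mlieBracket 𝓘(ℝ, E) X Z x
          + (d% f x (X x) • mlieBracket 𝓘(ℝ, E) Y Z x
          + f x • mlieBracket 𝓘(ℝ, E) X (mlieBracket 𝓘(ℝ, E) Y Z) x) := by
    have h : mlieBracket 𝓘(ℝ, E) Y (f • Z) =ᶠ[𝓝 x]
        (fun y ↦ d% f y (Y y)) • Z + f • mlieBracket 𝓘(ℝ, E) Y Z := by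
      filter_upwards [hf, hZ.eventually] with y hf hZ
      exact mlieBracket_smul_right (hmd hf) hZ.mdifferentiableAt
    rw [EventuallyEq.rfl.mlieBracket_vectorField_eq h,
      mlieBracket_add_right (hZ.smul hfY).mdifferentiableAt
        ((hY.mlieBracket hZ).smul hf).mdifferentiableAt,
      mlieBracket_smul_right (hmd hfY.self_of_nhds) hZ.mdifferentiableAt,
      mlieBracket_smul_right (hmd hf.self_of_nhds) (hY.mlieBracket hZ).mdifferentiableAt]
  -- Expanding Jacobi for `X, Y, f • Z` by the Leibniz rule and removing `f` times Jacobi for `X, Y,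
  -- Z` leaves the desired scalar identity multiplied by `Z x = v ≠ 0`.
  have h := jacobi hX hY (hZ.smul hf)
  rw [key hY hfY, key hX hfX, mlieBracket_smul_right (hmd hf.self_of_nhds) hZ.mdifferentiableAt,
    jacobi hX hY hZ] at h
  have hZx : Z x = v := FiberBundle.extend_apply_self ..
  have h' : (d% f x (mlieBracket 𝓘(ℝ, E) X Y x) - (d% (fun y ↦ d% f y (Y y)) x (X x) -
      d% (fun y ↦ d% f y (X y)) x (Y x))) • v = 0 := by
    rw [hZx] at h
    linear_combination (norm := module) (-1 : ℝ) • h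
  exact sub_eq_zero.1 ((smul_eq_zero.1 h').resolve_right hv)

end FiniteDimensional

end Connections

/-! ### The covariant differential of a one-form. -/

section CovariantDifferential

variable {E : Type*} [NormedAddCommGroup E] [NormedSpace ℝ E] [FiniteDimensional ℝ E]
  {M : Type*} [TopologicalSpace M] [ChartedSpace E M] [IsManifold 𝓘(ℝ, E) ∞ M]
  {X Y Z : VField E M} {x : M}

theorem SmoothOneForm.mdifferentiableAt_apply {η : OneForm E M} (hη : SmoothOneForm η)
    (hX : MDiffAt (T% X) x) : MDiffAt (fun y ↦ η y (X y)) x := by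
  have := MDifferentiableAt.clm_bundle_apply (F₂ := ℝ) (E₂ := Trivial M ℝ) (b := fun y : M ↦ y)
    (ϕ := η) ((hη x).mdifferentiableAt (by simp)) hX
  exact (mdifferentiableAt_section _ _).1 this

/-- When `Y` is multiplied by `f`, both terms produce `df · η(Y)`, and these cancel. -/
theorem tensorialAt_nabla (D : Connection E M) {η : OneForm E M} (hη : SmoothOneForm η) (x : M) :
    TensorialAt 𝓘(ℝ, E) E
      (fun Y : VField E M ↦ d% (fun y ↦ η y (Y y)) x - (η x).comp (D Y x)) x where
  smul {f Y} hf hY := by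
    have := mvfderiv_mul hf (hη.mdifferentiableAt_apply hY)
    ext v
    have h2 : (fun y ↦ η y ((f • Y) y)) = f * fun y ↦ η y (Y y) := by ext; simp
    rw [h2, this]
    simp [D.isCovariantDerivativeOnUniv.leibniz hY hf]
    ring
  add {Y Z} hY hZ := by
    have := mvfderiv_add (hη.mdifferentiableAt_apply hY) (hη.mdifferentiableAt_apply hZ)
    have h2 : (fun y ↦ η y ((Y + Z) y)) = (fun y ↦ η y (Y y)) + fun y ↦ η y (Z y) := by
      ext; simp
    ext v
    rw [h2, this]
    simp [D.isCovariantDerivativeOnUniv.add hY hZ]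
    ring

/-- The covariant differential `∇η` of a one-form; `nabla D hη x v w` is `(∇_w η) v`. -/
noncomputable def nabla (D : Connection E M) {η : OneForm E M} (hη : SmoothOneForm η) (x : M) :
    TangentSpace 𝓘(ℝ, E) x →L[ℝ] TangentSpace 𝓘(ℝ, E) x →L[ℝ] ℝ :=
  TensorialAt.mkHom _ x (tensorialAt_nabla D hη x)

theorem mvfderiv_oneForm_apply (D : Connection E M) {η : OneForm E M} (hη : SmoothOneForm η)
    (hY : SmoothNear Y x) :
    d% (fun y ↦ η y (Y y)) x (X x) = nabla D hη x (Y x) (X x) + η x (cov D X Y x) := by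
  rw [nabla, TensorialAt.mkHom_apply _ hY.mdifferentiableAt]
  simp [cov]

end CovariantDifferential

/-! ### The connections and curvature tensors in terms of the Levi-Civita connection. -/

section Kahler

variable {E : Type*} [NormedAddCommGroup E] [NormedSpace ℝ E] [FiniteDimensional ℝ E]
  {M : Type*} [TopologicalSpace M] [ChartedSpace E M] [IsManifold 𝓘(ℝ, E) ∞ M]
  {X Y Z : VField E M} {x : M} {D : Connection E M} {A : EndField E M} {η : OneForm E M}

theorem cov_quarterSymmetric (D : Connection E M) (A : EndField E M) (η : OneForm E M)
    (X Y : VField E M) :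
    cov (quarterSymmetric D A η) X Y = cov D X Y - (fun x ↦ η x (X x)) • A.app Y := by
  ext x
  simp [cov, quarterSymmetric, CovariantDerivative.addOneForm, quarterSymmetricForm, EndField.app]
  abel

theorem torsion_quarterSymmetric (hD : D.torsion = 0) (A : EndField E M) (η : OneForm E M)
    (v w : TangentSpace 𝓘(ℝ, E) x) :
    (quarterSymmetric D A η).torsion x v w = η x w • A x v - η x v • A x w := by
  have h : D.torsion x v w = 0 := by simp [hD]
  rw [CovariantDerivative.torsion_apply_eq_extend] at h ⊢
  have := congrFun (cov_quarterSymmetric D A η (FiberBundle.extend E v) (FiberBundle.extend E w)) x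
  have h2 := congrFun (cov_quarterSymmetric D A η (FiberBundle.extend E w) (FiberBundle.extend E v)) x
  simp only [cov] at this h2
  rw [this, h2]
  simp [cov, EndField.app] at h ⊢
  linear_combination (norm := module) (1 : ℝ) • h

/-- Adding the torsion `T¹(Y, X) = η(X) AY - η(Y) AX` exchanges the roles of `X` and `Y` in the
correction term. -/
theorem cov_conj_quarterSymmetric (hD : D.torsion = 0) (A : EndField E M) (η : OneForm E M)
    (X Y : VField E M) :
    cov (conj (quarterSymmetric D A η)) X Y = cov D X Y - (fun x ↦ η x (Y x)) • A.app X := by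
  have h := cov_quarterSymmetric D A η X Y
  ext x
  have h := congrFun h x
  simp [cov, conj, CovariantDerivative.addOneForm, torsion_quarterSymmetric hD, EndField.app] at h ⊢
  rw [h]
  abel

theorem cov_quarterSymmetric_apply (D : Connection E M) (A : EndField E M) (η : OneForm E M)
    (X Y : VField E M) (x : M) :
    cov (quarterSymmetric D A η) X Y x = cov D X Y x - η x (X x) • A x (Y x) := by
  rw [cov_quarterSymmetric]; rfl

theorem cov_conj_apply (hD : D.torsion = 0) (A : EndField E M) (η : OneForm E M)
    (X Y : VField E M) (x : M) :
    cov (conj (quarterSymmetric D A η)) X Y x = cov D X Y x - η x (Y x) • A x (X x) := by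
  rw [cov_conj_quarterSymmetric hD]; rfl

theorem cov_symmPart (D₁ : Connection E M) (X Y : VField E M) :
    cov (symmPart D₁) X Y = (1 / 2 : ℝ) • (cov D₁ X Y + cov (conj D₁) X Y) := by
  ext x
  simp [cov, symmPart]
  module

theorem cov_apply (D : Connection E M) (X Y : VField E M) (x : M) : cov D X Y x = D Y x (X x) :=
  rfl

variable [T2Space M] [RiemannianBundle (fun x : M ↦ TangentSpace 𝓘(ℝ, E) x)]
  [IsContMDiffRiemannianBundle 𝓘(ℝ, E) ∞ E (fun x : M ↦ TangentSpace 𝓘(ℝ, E) x)]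

theorem IsKahler.cov_app (h : IsKahler D A) (hY : SmoothNear Y x) :
    cov D X (A.app Y) x = A x (cov D X Y x) :=
  h.parallel Y x hY.mdifferentiableAt _

theorem IsKahler.smoothNear_cov (h : IsKahler D A) (hX : SmoothNear X x) (hY : SmoothNear Y x) :
    SmoothNear (cov D X Y) x :=
  hX.cov h.leviCivita.smooth hY

theorem IsKahler.smoothNear_app (h : IsKahler D A) (hX : SmoothNear X x) :
    SmoothNear (A.app X) x :=
  hX.app h.almostHermitian.smooth

/-- `∇_X (∇¹_Y Z)` at a point. -/
theorem IsKahler.cov_cov_quarterSymmetric (h : IsKahler D A) (hη : SmoothOneForm η)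
    (hY : SmoothNear Y x) (hZ : SmoothNear Z x) :
    cov D X (cov (quarterSymmetric D A η) Y Z) x = cov D X (cov D Y Z) x
      - ((nabla D hη x (Y x) (X x) + η x (cov D X Y x)) • A x (Z x)
        + η x (Y x) • A x (cov D X Z x)) := by
  rw [cov_quarterSymmetric, cov_sub_smul_apply D (hY.oneForm_apply hη) (h.smoothNear_cov hY hZ)
    (h.smoothNear_app hZ), mvfderiv_oneForm_apply D hη hY, h.cov_app hZ]
  rfl

/-- `∇_X (∇²_Y Z)` at a point. -/
theorem IsKahler.cov_cov_conj (h : IsKahler D A) (hη : SmoothOneForm η)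
    (hY : SmoothNear Y x) (hZ : SmoothNear Z x) :
    cov D X (cov (conj (quarterSymmetric D A η)) Y Z) x = cov D X (cov D Y Z) x
      - ((nabla D hη x (Z x) (X x) + η x (cov D X Z x)) • A x (Y x)
        + η x (Z x) • A x (cov D X Y x)) := by
  rw [cov_conj_quarterSymmetric h.leviCivita.torsion_free,
    cov_sub_smul_apply D (hZ.oneForm_apply hη) (h.smoothNear_cov hY hZ)
    (h.smoothNear_app hY), mvfderiv_oneForm_apply D hη hZ, h.cov_app hY]
  rfl

theorem IsKahler.smoothNear_cov_quarterSymmetric (h : IsKahler D A) (hη : SmoothOneForm η)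
    (hX : SmoothNear X x) (hY : SmoothNear Y x) :
    SmoothNear (cov (quarterSymmetric D A η) X Y) x := by
  rw [cov_quarterSymmetric]
  exact (h.smoothNear_cov hX hY).sub ((h.smoothNear_app hY).smul (hX.oneForm_apply hη))

theorem IsKahler.smoothNear_cov_conj (h : IsKahler D A) (hη : SmoothOneForm η)
    (hX : SmoothNear X x) (hY : SmoothNear Y x) :
    SmoothNear (cov (conj (quarterSymmetric D A η)) X Y) x := by
  rw [cov_conj_quarterSymmetric h.leviCivita.torsion_free]
  exact (h.smoothNear_cov hX hY).sub ((h.smoothNear_app hX).smul (hY.oneForm_apply hη))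

/-! ### The curvature tensors -/

/-- The terms quadratic in `η` are `η(X) η(Y) A²Z`, symmetric in `X` and `Y`, so only the exterior
derivative of `η` survives. -/
theorem IsKahler.curv1_apply (h : IsKahler D A) (hη : SmoothOneForm η)
    (hX : SmoothNear X x) (hY : SmoothNear Y x) (hZ : SmoothNear Z x) :
    curv1 (quarterSymmetric D A η) X Y Z x = curv D X Y Z x
      - (nabla D hη x (Y x) (X x) - nabla D hη x (X x) (Y x)) • A x (Z x) := by
  have hT := h.leviCivita.torsion_free
  simp only [curv1, curv, Pi.sub_apply, cov_quarterSymmetric_apply,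
    h.cov_cov_quarterSymmetric hη hY hZ, h.cov_cov_quarterSymmetric hη hX hZ,
    mlieBracket_eq_cov_sub_cov hT hX hY, map_sub, map_smul]
  module

theorem IsKahler.curv2_apply (h : IsKahler D A) (hη : SmoothOneForm η)
    (hX : SmoothNear X x) (hY : SmoothNear Y x) (hZ : SmoothNear Z x) :
    curv2 (quarterSymmetric D A η) X Y Z x = curv D X Y Z x
      - (nabla D hη x (Z x) (X x) + η x (A x (X x)) * η x (Z x)) • A x (Y x)
      + (nabla D hη x (Z x) (Y x) + η x (A x (Y x)) * η x (Z x)) • A x (X x) := by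
  have hT := h.leviCivita.torsion_free
  simp only [curv2, curv, Pi.sub_apply, cov_conj_apply hT,
    h.cov_cov_conj hη hY hZ, h.cov_cov_conj hη hX hZ,
    mlieBracket_eq_cov_sub_cov hT hX hY, map_sub, map_smul, smul_eq_mul]
  module

theorem IsKahler.curv3_apply (h : IsKahler D A) (hη : SmoothOneForm η)
    (hX : SmoothNear X x) (hY : SmoothNear Y x) (hZ : SmoothNear Z x) :
    curv3 (quarterSymmetric D A η) X Y Z x = curv D X Y Z x
      - (nabla D hη x (Y x) (X x) + η x (A x (X x)) * η x (Y x)) • A x (Z x)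
      + (nabla D hη x (Z x) (Y x) + η x (Y x) * η x (A x (Z x))) • A x (X x) := by
  have hT := h.leviCivita.torsion_free
  simp only [curv3, curv, Pi.sub_apply, Pi.add_apply, cov_quarterSymmetric_apply, cov_conj_apply hT,
    h.cov_cov_quarterSymmetric hη hY hZ, h.cov_cov_conj hη hX hZ,
    -- The directions `∇¹_Y X` and `∇²_X Y` differ by `-[X,Y]`; unfolding `cov` here makes linearity
    -- in the direction available, so that this difference matches the bracket term of `R`.
    cov_apply D (mlieBracket _ _ _), cov_apply D (cov _ _ _),
    mlieBracket_eq_cov_sub_cov hT hX hY, map_sub, map_smul, smul_eq_mul, h.almostHermitian.sq]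
  module

theorem IsKahler.two_smul_curv5_apply (h : IsKahler D A) (hη : SmoothOneForm η)
    (hX : SmoothNear X x) (hY : SmoothNear Y x) (hZ : SmoothNear Z x) :
    (2 : ℝ) • curv5 (quarterSymmetric D A η) X Y Z x = (2 : ℝ) • curv D X Y Z x
      - (nabla D hη x (Y x) (X x) - nabla D hη x (X x) (Y x)) • A x (Z x)
      - (nabla D hη x (Z x) (X x) + η x (X x) * η x (A x (Z x))) • A x (Y x)
      + (nabla D hη x (Z x) (Y x) + η x (A x (Y x)) * η x (Z x)) • A x (X x)
      - (η x (X x) * η x (Y x)) • Z x + (η x (Y x) * η x (Z x)) • X x := by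
  have hT := h.leviCivita.torsion_free
  simp only [curv5, curv, Pi.sub_apply, Pi.add_apply, Pi.smul_apply,
    cov_quarterSymmetric_apply, cov_conj_apply hT,
    h.cov_cov_quarterSymmetric hη hY hZ, h.cov_cov_conj hη hX hZ,
    h.cov_cov_quarterSymmetric hη hX hZ, h.cov_cov_conj hη hY hZ,
    mlieBracket_eq_cov_sub_cov hT hX hY, map_sub, map_smul, smul_eq_mul, h.almostHermitian.sq]
  module

theorem IsKahler.four_smul_curv0_apply (h : IsKahler D A) (hη : SmoothOneForm η)
    (hX : SmoothNear X x) (hY : SmoothNear Y x) (hZ : SmoothNear Z x) :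
    (4 : ℝ) • curv0 (quarterSymmetric D A η) X Y Z x = (4 : ℝ) • curv D X Y Z x
      - (2 * (nabla D hη x (Y x) (X x) - nabla D hη x (X x) (Y x))) • A x (Z x)
      - (2 * nabla D hη x (Z x) (X x) + η x (A x (X x)) * η x (Z x)
        + η x (X x) * η x (A x (Z x))) • A x (Y x)
      + (2 * nabla D hη x (Z x) (Y x) + η x (A x (Y x)) * η x (Z x)
        + η x (Y x) * η x (A x (Z x))) • A x (X x)
      - (η x (X x) * η x (Z x)) • Y x + (η x (Y x) * η x (Z x)) • X x := by
  have hT := h.leviCivita.torsion_free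
  -- Since `∇⁰` is half a sum, its second derivatives are a quarter of the four mixed ones.
  have key {X Y : VField E M} (hX : SmoothNear X x) (hY : SmoothNear Y x) :
      cov (symmPart (quarterSymmetric D A η)) X
        (cov (symmPart (quarterSymmetric D A η)) Y Z) x = (1 / 4 : ℝ) •
      (cov (quarterSymmetric D A η) X (cov (quarterSymmetric D A η) Y Z) x
      + cov (quarterSymmetric D A η) X (cov (conj (quarterSymmetric D A η)) Y Z) x
      + cov (conj (quarterSymmetric D A η)) X (cov (quarterSymmetric D A η) Y Z) x
      + cov (conj (quarterSymmetric D A η)) X (cov (conj (quarterSymmetric D A η)) Y Z) x) := by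
    have h1 := h.smoothNear_cov_quarterSymmetric hη hY hZ
    have h2 := h.smoothNear_cov_conj hη hY hZ
    have h3 := h1.add h2
    rw [cov_symmPart _ Y Z, cov_const_smul_apply _ _ h3, cov_symmPart, Pi.smul_apply, Pi.add_apply,
      cov_add_apply _ h1 h2, cov_add_apply _ h1 h2]
    module
  simp only [curv0, curv, Pi.sub_apply, key hX hY, key hY hX, cov_symmPart _ (mlieBracket _ _ _) Z,
    Pi.smul_apply, Pi.add_apply,
    cov_quarterSymmetric_apply, cov_conj_apply hT,
    h.cov_cov_quarterSymmetric hη hY hZ, h.cov_cov_conj hη hX hZ,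
    h.cov_cov_quarterSymmetric hη hX hZ, h.cov_cov_conj hη hY hZ,
    mlieBracket_eq_cov_sub_cov hT hX hY, map_sub, map_smul, smul_eq_mul, h.almostHermitian.sq]
  module

end Kahler

/-- A skew-symmetric endomorphism of a Euclidean space is trace-free. -/
theorem _root_.LinearMap.trace_eq_zero_of_inner_skew {V : Type*} [NormedAddCommGroup V]
    [InnerProductSpace ℝ V] [FiniteDimensional ℝ V] (L : V →ₗ[ℝ] V)
    (h : ∀ v w, inner ℝ (L v) w + inner ℝ v (L w) = 0) : LinearMap.trace ℝ V L = 0 := by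
  rw [L.trace_eq_sum_inner (stdOrthonormalBasis ℝ V)]
  refine Finset.sum_eq_zero fun i _ ↦ ?_
  have := h (stdOrthonormalBasis ℝ V i) (stdOrthonormalBasis ℝ V i)
  rw [real_inner_comm] at this
  linarith

/-! ### Comparison of traces. -/

section Trace

variable {E : Type*} [NormedAddCommGroup E] [NormedSpace ℝ E] [FiniteDimensional ℝ E]
  {M : Type*} [TopologicalSpace M] [ChartedSpace E M] [IsManifold 𝓘(ℝ, E) ∞ M] {x : M}

theorem trace_add_of {Φ Ψ Θ : VField E M → VField E M}
    (h : ∀ v : TangentSpace 𝓘(ℝ, E) x,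
      Φ (FiberBundle.extend E v) x
        = Ψ (FiberBundle.extend E v) x + Θ (FiberBundle.extend E v) x) :
    trace Φ x = trace Ψ x + trace Θ x := by
  simp [trace, h, Finset.sum_add_distrib]

/-- Two multiples of operators that differ by the linear map `L` have traces that differ by the
trace of `L`. -/
theorem mul_trace_eq {Φ Ψ : VField E M → VField E M} (c : ℝ)
    (L : TangentSpace 𝓘(ℝ, E) x →ₗ[ℝ] TangentSpace 𝓘(ℝ, E) x)
    (h : ∀ v : TangentSpace 𝓘(ℝ, E) x,
      c • Φ (FiberBundle.extend E v) x = c • Ψ (FiberBundle.extend E v) x + L v) :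
    c * trace Φ x = c * trace Ψ x + LinearMap.trace ℝ _ L := by
  rw [LinearMap.trace_eq_matrix_trace ℝ (finBasis ℝ (TangentSpace 𝓘(ℝ, E) x))]
  simp only [trace, Finset.mul_sum, Matrix.trace, Matrix.diag, LinearMap.toMatrix_apply,
    ← Finset.sum_add_distrib]
  refine Finset.sum_congr rfl fun i _ ↦ ?_
  rw [← smul_eq_mul, ← map_smul, h]
  simp

end Trace

/-! ### Symmetries of the Levi-Civita curvature and trace of `A`. -/

section Kahler

variable {E : Type*} [NormedAddCommGroup E] [NormedSpace ℝ E] [FiniteDimensional ℝ E]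
  {M : Type*} [TopologicalSpace M] [ChartedSpace E M] [IsManifold 𝓘(ℝ, E) ∞ M]
  [RiemannianBundle (fun x : M ↦ TangentSpace 𝓘(ℝ, E) x)]
  [IsContMDiffRiemannianBundle 𝓘(ℝ, E) ∞ E (fun x : M ↦ TangentSpace 𝓘(ℝ, E) x)]
  {X Y Z W W' : VField E M} {x : M} {D : Connection E M} {A : EndField E M} {η : OneForm E M}

/-- An isometry with square `-I` is skew: `⟨Av, w⟩ = -⟨Av, A(Aw)⟩ = -⟨v, Aw⟩`. -/
theorem IsAlmostHermitian.trace_eq_zero (h : IsAlmostHermitian A) (x : M) :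
    LinearMap.trace ℝ (TangentSpace 𝓘(ℝ, E) x) (A x) = 0 := by
  refine LinearMap.trace_eq_zero_of_inner_skew (V := TangentSpace 𝓘(ℝ, E) x) _ fun v w ↦ ?_
  have := h.isometry x v (A x w)
  rw [h.sq, inner_neg_right] at this
  simp only [ContinuousLinearMap.coe_coe]
  linarith

variable [T2Space M]

theorem IsLeviCivita.smoothNear_cov (h : IsLeviCivita D) (hX : SmoothNear X x)
    (hY : SmoothNear Y x) : SmoothNear (cov D X Y) x :=
  hX.cov h.smooth hY

theorem curv_antisymm (D : Connection E M) (X Y Z : VField E M) :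
    curv D X Y Z = -curv D Y X Z := by
  ext x
  simp only [curv, cov, mlieBracket_swap (V := X), Pi.sub_apply, Pi.neg_apply, map_neg]
  abel

/-- The first Bianchi identity. -/
theorem IsLeviCivita.bianchi (h : IsLeviCivita D) (hX : SmoothNear X x) (hY : SmoothNear Y x)
    (hZ : SmoothNear Z x) :
    curv D X Y Z x + curv D Y Z X x + curv D Z X Y x = 0 := by
  -- Torsion-freeness rewrites `∇_{[X,Y]} Z` as `∇_Z [X,Y] - [Z,[X,Y]]`. In the cyclic sum the
  -- second derivatives then cancel and the Jacobi identity remains.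
  have key {X Y Z : VField E M} (hX : SmoothNear X x) (hY : SmoothNear Y x)
      (hZ : SmoothNear Z x) : cov D (mlieBracket 𝓘(ℝ, E) X Y) Z x =
      cov D Z (cov D X Y) x - cov D Z (cov D Y X) x
        - mlieBracket 𝓘(ℝ, E) Z (mlieBracket 𝓘(ℝ, E) X Y) x := by
    rw [mlieBracket_eq_cov_sub_cov h.torsion_free hZ (hX.mlieBracket hY),
      cov_congr D ((h.smoothNear_cov hX hY).sub (h.smoothNear_cov hY hX))
        (eventually_mlieBracket_eq h.torsion_free hX hY),
      cov_sub_apply D (h.smoothNear_cov hX hY) (h.smoothNear_cov hY hX)]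
    abel
  have hJ := jacobi hX hY hZ
  rw [mlieBracket_swap_apply (V := mlieBracket 𝓘(ℝ, E) X Y), mlieBracket_swap (V := X) (W := Z)]
    at hJ
  have hn : mlieBracket 𝓘(ℝ, E) Y (-mlieBracket 𝓘(ℝ, E) Z X) x
      = - mlieBracket 𝓘(ℝ, E) Y (mlieBracket 𝓘(ℝ, E) Z X) x := by
    have : IsManifold 𝓘(ℝ, E) (minSmoothness ℝ 2) M := isManifold_minSmoothness_two
    simpa using mlieBracket_const_smul_right (c := (-1 : ℝ)) (I := 𝓘(ℝ, E)) (V := Y)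
      (hZ.mlieBracket hX).mdifferentiableAt
  rw [hn] at hJ
  simp only [curv, Pi.sub_apply, key hX hY hZ, key hY hZ hX, key hZ hX hY, hJ]
  abel

theorem IsLeviCivita.mvfderiv_inner (h : IsLeviCivita D) (X : VField E M) (hW : SmoothNear W x)
    (hW' : SmoothNear W' x) :
    d% (fun y ↦ inner ℝ (W y) (W' y)) x (X x) =
      inner ℝ (cov D X W x) (W' x) + inner ℝ (W x) (cov D X W' x) :=
  h.metric.mvfderiv_inner_eq X hW.mdifferentiableAt hW'.mdifferentiableAt

theorem SmoothNear.inner (hW : SmoothNear W x) (hW' : SmoothNear W' x) :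
    ∀ᶠ y in 𝓝 x, CMDiffAt ∞ (fun y ↦ inner ℝ (W y) (W' y)) y := by
  filter_upwards [hW, hW'] with y hW hW' using
    ContMDiffAt.inner_bundle (F := E) (E := fun x : M ↦ TangentSpace 𝓘(ℝ, E) x) (b := id) hW hW'

theorem mvfderiv_congr {f g : M → ℝ} (h : f =ᶠ[𝓝 x] g) : d% f x = d% g x := by
  simp only [mvfderiv, h.mfderiv_eq (I := 𝓘(ℝ, E))]
  rfl

/-- The curvature operators of the Levi-Civita connection are skew-symmetric. -/
theorem IsLeviCivita.inner_curv (h : IsLeviCivita D) (hX : SmoothNear X x) (hY : SmoothNear Y x)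
    (hW : SmoothNear W x) (hW' : SmoothNear W' x) :
    inner ℝ (curv D X Y W x) (W' x) + inner ℝ (W x) (curv D X Y W' x) = 0 := by
  let f : M → ℝ := fun y ↦ inner ℝ (W y) (W' y)
  have hf : ∀ᶠ y in 𝓝 x, CMDiffAt ∞ f y := hW.inner hW'
  have h1 {X : VField E M} : (fun y ↦ d% f y (X y)) =ᶠ[𝓝 x]
      (fun y ↦ inner ℝ (cov D X W y) (W' y)) + fun y ↦ inner ℝ (W y) (cov D X W' y) := by
    filter_upwards [hW.eventually, hW'.eventually] with y hW hW' using h.mvfderiv_inner X hW hW'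
  -- Smoothness of `Xf` is read off from the metric formula `h1`, as required by
  -- `mvfderiv_mlieBracket`.
  have h2 {X : VField E M} (hX : SmoothNear X x) :
      ∀ᶠ y in 𝓝 x, CMDiffAt ∞ (fun y ↦ d% f y (X y)) y := by
    filter_upwards [eventually_eventually_nhds.2 (h1 (X := X)), (h.smoothNear_cov hX hW).inner hW',
      hW.inner (h.smoothNear_cov hX hW')] with y hy h1 h2
    exact (h1.add h2).congr_of_eventuallyEq hy
  have h3 {X Y : VField E M} (hY : SmoothNear Y x) :
      d% (fun y ↦ d% f y (Y y)) x (X x) =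
        inner ℝ (cov D X (cov D Y W) x) (W' x) + inner ℝ (cov D Y W x) (cov D X W' x)
        + (inner ℝ (cov D X W x) (cov D Y W' x) + inner ℝ (W x) (cov D X (cov D Y W') x)) := by
    have hd {g : M → ℝ} (hg : ∀ᶠ y in 𝓝 x, CMDiffAt ∞ g y) : MDiffAt g x :=
      hg.self_of_nhds.mdifferentiableAt (by simp)
    rw [← h.mvfderiv_inner X (h.smoothNear_cov hY hW) hW',
      ← h.mvfderiv_inner X hW (h.smoothNear_cov hY hW'), mvfderiv_congr h1,
      mvfderiv_add (hd ((h.smoothNear_cov hY hW).inner hW'))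
        (hd (hW.inner (h.smoothNear_cov hY hW')))]
    rfl
  -- In `X(Yf) - Y(Xf)` the products of first derivatives are symmetric in `X` and `Y` and drop out.
  have h4 := mvfderiv_mlieBracket hf hX hY (h2 hX) (h2 hY)
  rw [h3 hX, h3 hY, h.mvfderiv_inner _ hW hW'] at h4
  simp only [curv, Pi.sub_apply, inner_sub_left, inner_sub_right]
  linarith

theorem IsLeviCivita.trace_curv (h : IsLeviCivita D) (hX : SmoothNear X x)
    (hY : SmoothNear Y x) : primeTrace (curv D) X Y x = 0 := by
  let b := finBasis ℝ (TangentSpace 𝓘(ℝ, E) x)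
  -- `L` is prescribed on the basis used by `trace`, so its trace is the required one, and skewness
  -- need only be checked on pairs of basis vectors.
  let L : TangentSpace 𝓘(ℝ, E) x →ₗ[ℝ] TangentSpace 𝓘(ℝ, E) x :=
    b.constr ℝ fun i ↦ curv D X Y (FiberBundle.extend E (b i)) x
  have hL : primeTrace (curv D) X Y x = LinearMap.trace ℝ _ L := by
    rw [LinearMap.trace_eq_matrix_trace ℝ b]
    simp [primeTrace, trace, Matrix.trace, LinearMap.toMatrix_apply, L, b]
  rw [hL]
  refine LinearMap.trace_eq_zero_of_inner_skew (V := TangentSpace 𝓘(ℝ, E) x) _ fun v w ↦ ?_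
  let B : TangentSpace 𝓘(ℝ, E) x →ₗ[ℝ] TangentSpace 𝓘(ℝ, E) x →ₗ[ℝ] ℝ :=
    (innerₗ (TangentSpace 𝓘(ℝ, E) x)).comp L + (innerₗ (TangentSpace 𝓘(ℝ, E) x)).compl₂ L
  have hB : B = 0 := by
    refine LinearMap.ext_basis b b fun i j ↦ ?_
    have := h.inner_curv hX hY (smoothNear_extend (b i)) (smoothNear_extend (b j))
    simpa [B, L] using this
  simpa [B] using LinearMap.congr_fun₂ hB v w

/-- The Ricci tensor of the Levi-Civita connection is symmetric. -/
theorem IsLeviCivita.ric_symm (h : IsLeviCivita D) (hY : SmoothNear Y x) (hZ : SmoothNear Z x) :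
    ric (curv D) Y Z x = ric (curv D) Z Y x := by
  -- Bianchi reads `R(V,Z)Y = R(V,Y)Z + R(Y,Z)V`; the trace is taken over `V`.
  have h1 : ric (curv D) Z Y x = ric (curv D) Y Z x + primeTrace (curv D) Y Z x := by
    refine trace_add_of fun v ↦ ?_
    have hb := h.bianchi (smoothNear_extend v) hY hZ
    rw [curv_antisymm D Z] at hb
    simp only [Pi.neg_apply] at hb
    linear_combination (norm := module) (-1 : ℝ) • hb
  rw [h1, h.trace_curv hY hZ, add_zero]

end Kahler

/-! ### Ricci tensors and traces of the curvatures of `∇¹`. -/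

section Ricci

variable {E : Type*} [NormedAddCommGroup E] [NormedSpace ℝ E] [FiniteDimensional ℝ E]
  {M : Type*} [TopologicalSpace M] [ChartedSpace E M] [IsManifold 𝓘(ℝ, E) ∞ M]
  [RiemannianBundle (fun x : M ↦ TangentSpace 𝓘(ℝ, E) x)]
  [IsContMDiffRiemannianBundle 𝓘(ℝ, E) ∞ E (fun x : M ↦ TangentSpace 𝓘(ℝ, E) x)]
  [T2Space M]
  {X Y Z : VField E M} {x : M} {D : Connection E M} {A : EndField E M} {η : OneForm E M}

theorem IsKahler.ric_curv1 (h : IsKahler D A) (hη : SmoothOneForm η)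
    (hY : SmoothNear Y x) (hZ : SmoothNear Z x) :
    ric (curv1 (quarterSymmetric D A η)) Y Z x = ric (curv D) Y Z x
      - (nabla D hη x (Y x) (A x (Z x)) - nabla D hη x (A x (Z x)) (Y x)) := by
  have := mul_trace_eq (x := x) (Φ := fun X ↦ curv1 (quarterSymmetric D A η) X Y Z)
    (Ψ := fun X ↦ curv D X Y Z) 1
    (LinearMap.smulRight ((nabla D hη x).flip (Y x) - nabla D hη x (Y x)).toLinearMap (A x (Z x)))
    fun v ↦ by
      simp [h.curv1_apply hη (smoothNear_extend v) hY hZ]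
      module
  simp only [one_mul, LinearMap.trace_smulRight] at this
  simp only [ric, this]
  simp
  ring

theorem IsKahler.ric_curv2 (h : IsKahler D A) (hη : SmoothOneForm η)
    (hY : SmoothNear Y x) (hZ : SmoothNear Z x) :
    ric (curv2 (quarterSymmetric D A η)) Y Z x = ric (curv D) Y Z x
      - nabla D hη x (Z x) (A x (Y x)) + η x (Y x) * η x (Z x) := by
  have := mul_trace_eq (x := x) (Φ := fun X ↦ curv2 (quarterSymmetric D A η) X Y Z)
    (Ψ := fun X ↦ curv D X Y Z) 1
    (LinearMap.smulRight (-nabla D hη x (Z x) - η x (Z x) • (η x).comp (A x)).toLinearMap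
      (A x (Y x))
      + (nabla D hη x (Z x) (Y x) + η x (A x (Y x)) * η x (Z x)) • (A x).toLinearMap)
    fun v ↦ by
      simp [h.curv2_apply hη (smoothNear_extend v) hY hZ]
      module
  simp only [one_mul, map_add, map_smul, LinearMap.trace_smulRight,
    h.almostHermitian.trace_eq_zero] at this
  simp only [ric, this]
  simp [h.almostHermitian.sq]
  ring

theorem IsKahler.ric_curv3 (h : IsKahler D A) (hη : SmoothOneForm η)
    (hY : SmoothNear Y x) (hZ : SmoothNear Z x) :
    ric (curv3 (quarterSymmetric D A η)) Y Z x = ric (curv D) Y Z x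
      - nabla D hη x (Y x) (A x (Z x)) + η x (Y x) * η x (Z x) := by
  have := mul_trace_eq (x := x) (Φ := fun X ↦ curv3 (quarterSymmetric D A η) X Y Z)
    (Ψ := fun X ↦ curv D X Y Z) 1
    (LinearMap.smulRight (-nabla D hη x (Y x) - η x (Y x) • (η x).comp (A x)).toLinearMap
      (A x (Z x))
      + (nabla D hη x (Z x) (Y x) + η x (Y x) * η x (A x (Z x))) • (A x).toLinearMap)
    fun v ↦ by
      simp [h.curv3_apply hη (smoothNear_extend v) hY hZ]
      module
  simp only [one_mul, map_add, map_smul, LinearMap.trace_smulRight,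
    h.almostHermitian.trace_eq_zero] at this
  simp only [ric, this]
  simp [h.almostHermitian.sq]
  ring

theorem IsKahler.primeTrace_curv3 (h : IsKahler D A) (hη : SmoothOneForm η)
    (hX : SmoothNear X x) (hY : SmoothNear Y x) :
    primeTrace (curv3 (quarterSymmetric D A η)) X Y x =
      nabla D hη x (A x (X x)) (Y x) - η x (X x) * η x (Y x) := by
  have := mul_trace_eq (x := x) (Φ := fun Z ↦ curv3 (quarterSymmetric D A η) X Y Z)
    (Ψ := fun Z ↦ curv D X Y Z) 1
    (LinearMap.smulRight ((nabla D hη x).flip (Y x) + η x (Y x) • (η x).comp (A x)).toLinearMap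
      (A x (X x))
      - (nabla D hη x (Y x) (X x) + η x (A x (X x)) * η x (Y x)) • (A x).toLinearMap)
    fun v ↦ by
      simp [h.curv3_apply hη hX hY (smoothNear_extend v)]
      module
  have h0 := h.leviCivita.trace_curv hX hY
  simp only [primeTrace] at h0
  simp only [one_mul, map_sub, map_smul, LinearMap.trace_smulRight,
    h.almostHermitian.trace_eq_zero, h0] at this
  simp only [primeTrace, this]
  simp [h.almostHermitian.sq]
  ring

/-- The factor `n - 1` combines the trace `n` of the identity with `-1` from the rank-one operator
`V ↦ -η(Y) η(V) Z`. -/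
theorem IsKahler.two_mul_ric_curv5 (h : IsKahler D A) (hη : SmoothOneForm η)
    (hY : SmoothNear Y x) (hZ : SmoothNear Z x) :
    2 * ric (curv5 (quarterSymmetric D A η)) Y Z x = 2 * ric (curv D) Y Z x
      - (nabla D hη x (Y x) (A x (Z x)) - nabla D hη x (A x (Z x)) (Y x))
      - nabla D hη x (Z x) (A x (Y x)) - η x (A x (Y x)) * η x (A x (Z x))
      + (finrank ℝ E - 1) * (η x (Y x) * η x (Z x)) := by
  have := mul_trace_eq (x := x) (Φ := fun X ↦ curv5 (quarterSymmetric D A η) X Y Z)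
    (Ψ := fun X ↦ curv D X Y Z) 2
    (LinearMap.smulRight ((nabla D hη x).flip (Y x) - nabla D hη x (Y x)).toLinearMap (A x (Z x))
      + LinearMap.smulRight (-nabla D hη x (Z x) - η x (A x (Z x)) • η x).toLinearMap (A x (Y x))
      + (nabla D hη x (Z x) (Y x) + η x (A x (Y x)) * η x (Z x)) • (A x).toLinearMap
      - LinearMap.smulRight (η x (Y x) • η x).toLinearMap (Z x)
      + (η x (Y x) * η x (Z x)) • LinearMap.id)
    fun v ↦ by
      rw [h.two_smul_curv5_apply hη (smoothNear_extend v) hY hZ]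
      simp
      module
  have hn : finrank ℝ (TangentSpace 𝓘(ℝ, E) x) = finrank ℝ E := rfl
  simp only [map_add, map_sub, map_smul, LinearMap.trace_smulRight, LinearMap.trace_id,
    h.almostHermitian.trace_eq_zero, hn] at this
  simp only [ric, this]
  simp
  ring

/-- The factor is `n` rather than `n - 1`: the term with `η ∘ A`, evaluated on `AY`, gives an extra
`η(Y) η(Z)` through `A² = -I`. -/
theorem IsKahler.four_mul_ric_curv0 (h : IsKahler D A) (hη : SmoothOneForm η)
    (hY : SmoothNear Y x) (hZ : SmoothNear Z x) :
    4 * ric (curv0 (quarterSymmetric D A η)) Y Z x = 4 * ric (curv D) Y Z x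
      - 2 * (nabla D hη x (Y x) (A x (Z x)) - nabla D hη x (A x (Z x)) (Y x))
      - 2 * nabla D hη x (Z x) (A x (Y x)) - η x (A x (Y x)) * η x (A x (Z x))
      + finrank ℝ E * (η x (Y x) * η x (Z x)) := by
  have := mul_trace_eq (x := x) (Φ := fun X ↦ curv0 (quarterSymmetric D A η) X Y Z)
    (Ψ := fun X ↦ curv D X Y Z) 4
    ((2 : ℝ) • LinearMap.smulRight ((nabla D hη x).flip (Y x) - nabla D hη x (Y x)).toLinearMap
        (A x (Z x))
      - LinearMap.smulRight ((2 : ℝ) • nabla D hη x (Z x) + η x (Z x) • (η x).comp (A x)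
        + η x (A x (Z x)) • η x).toLinearMap (A x (Y x))
      + (2 * nabla D hη x (Z x) (Y x) + η x (A x (Y x)) * η x (Z x)
        + η x (Y x) * η x (A x (Z x))) • (A x).toLinearMap
      - LinearMap.smulRight (η x (Z x) • η x).toLinearMap (Y x)
      + (η x (Y x) * η x (Z x)) • LinearMap.id)
    fun v ↦ by
      rw [h.four_smul_curv0_apply hη (smoothNear_extend v) hY hZ]
      simp
      module
  have hn : finrank ℝ (TangentSpace 𝓘(ℝ, E) x) = finrank ℝ E := rfl
  simp only [map_add, map_sub, map_smul, LinearMap.trace_smulRight, LinearMap.trace_id,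
    h.almostHermitian.trace_eq_zero, hn] at this
  simp only [ric, this]
  simp [h.almostHermitian.sq]
  ring

end Ricci

/-! ### The tensors `H` in terms of `R`, `Ric` and `A`. -/

section Main

variable {E : Type*} [NormedAddCommGroup E] [NormedSpace ℝ E] [FiniteDimensional ℝ E]
  {M : Type*} [TopologicalSpace M] [ChartedSpace E M] [IsManifold 𝓘(ℝ, E) ∞ M]
  [RiemannianBundle (fun x : M ↦ TangentSpace 𝓘(ℝ, E) x)]
  [IsContMDiffRiemannianBundle 𝓘(ℝ, E) ∞ E (fun x : M ↦ TangentSpace 𝓘(ℝ, E) x)]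
  [T2Space M]
  {X Y Z : VField E M} {x : M} {D : Connection E M} {A : EndField E M} {η : OneForm E M}

/-- Because `A² = -I`, replacing the last argument of `Ric¹` by `AX` turns its correction into
exactly the coefficient of `AZ` in `R - R¹`. -/
theorem IsKahler.H1_apply (h : IsKahler D A) (hη : SmoothOneForm η)
    (hX : SmoothNear X x) (hY : SmoothNear Y x) (hZ : SmoothNear Z x) :
    H1 (quarterSymmetric D A η) A X Y Z x =
      curv D X Y Z x + ric (curv D) Y (A.app X) x • A x (Z x) := by
  have hAX : A.app X x = A x (X x) := rfl
  have hAZ : A.app Z x = A x (Z x) := rfl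
  simp only [H1, Pi.add_apply, Pi.smul_apply', h.curv1_apply hη hX hY hZ,
    h.ric_curv1 hη hY (h.smoothNear_app hX), hAX, hAZ, h.almostHermitian.sq, map_neg,
    neg_apply]
  module

theorem IsKahler.H2_apply (h : IsKahler D A) (hη : SmoothOneForm η)
    (hX : SmoothNear X x) (hY : SmoothNear Y x) (hZ : SmoothNear Z x) :
    H2 (quarterSymmetric D A η) A X Y Z x =
      curv D X Y Z x + ric (curv D) (A.app X) Z x • A x (Y x)
        - ric (curv D) (A.app Y) Z x • A x (X x) := by
  have hA (W : VField E M) : A.app W x = A x (W x) := rfl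
  simp only [H2, Pi.add_apply, Pi.sub_apply, Pi.smul_apply', h.curv2_apply hη hX hY hZ,
    h.ric_curv2 hη (h.smoothNear_app hX) hZ, h.ric_curv2 hη (h.smoothNear_app hY) hZ,
    hA, h.almostHermitian.sq, map_neg]
  module

/-- The combination `4Ric⁰(X,Z) - 2Ric¹(X,Z) - Ric³(Z,X) - 'R³(AZ,AX)` equals `Ric(X,Z) + (n-1) η(X)
η(Z)`; divided by `n - 1`, its last term cancels the `-η(X) η(Z) Y` of `4R⁰`. The difference
`Ric³(Z,AX) - 'R³(AZ,X)` cancels the coefficient of `AY`. -/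
theorem IsKahler.four_smul_H0_apply (h : IsKahler D A) (hη : SmoothOneForm η)
    (hn : (finrank ℝ E : ℝ) - 1 ≠ 0)
    (hX : SmoothNear X x) (hY : SmoothNear Y x) (hZ : SmoothNear Z x) :
    (4 : ℝ) • H0 (quarterSymmetric D A η) A X Y Z x =
      (4 : ℝ) • curv D X Y Z x
        + (1 / ((finrank ℝ E : ℝ) - 1)) • (ric (curv D) X Z x • Y x - ric (curv D) Y Z x • X x)
        + (2 * ric (curv D) Y (A.app X) x) • A x (Z x)
        + ric (curv D) (A.app X) Z x • A x (Y x) - ric (curv D) (A.app Y) Z x • A x (X x) := by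
  have hA (W : VField E M) : A.app W x = A x (W x) := rfl
  have hAX := h.smoothNear_app hX
  have hAY := h.smoothNear_app hY
  have hAZ := h.smoothNear_app hZ
  have hR := (eq_inv_smul_iff₀ four_ne_zero).2 (h.four_smul_curv0_apply hη hX hY hZ)
  have hRic {Y : VField E M} (hY : SmoothNear Y x) :=
    (eq_inv_mul_iff_mul_eq₀ four_ne_zero).2 (h.four_mul_ric_curv0 hη hY hZ)
  have h1 := h.leviCivita.ric_symm hZ hX
  have h2 := h.leviCivita.ric_symm hZ hY
  have h3 := h.leviCivita.ric_symm hZ hAX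
  have h4 := h.leviCivita.ric_symm hZ hAY
  -- With `m = n - 1` the denominators become a single nonzero variable.
  obtain ⟨m, hm⟩ : ∃ m : ℝ, (finrank ℝ E : ℝ) = m + 1 := ⟨finrank ℝ E - 1, by ring⟩
  simp only [H0, Pi.add_apply, Pi.sub_apply, Pi.smul_apply', Pi.smul_apply, hR, hRic hX, hRic hY,
    h.ric_curv1 hη hX hZ, h.ric_curv1 hη hY hZ, h.ric_curv1 hη hY hAX,
    h.ric_curv3 hη hZ hX, h.ric_curv3 hη hZ hY, h.ric_curv3 hη hZ hAX, h.ric_curv3 hη hZ hAY,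
    h.primeTrace_curv3 hη hAZ hAX, h.primeTrace_curv3 hη hAZ hAY, h.primeTrace_curv3 hη hAZ hX,
    h.primeTrace_curv3 hη hAZ hY, h1, h2, h3, h4,
    hA, h.almostHermitian.sq, map_neg, neg_apply]
  rw [hm, add_sub_cancel_right] at hn ⊢
  match_scalars <;> field_simp <;> ring

/-- Here `2Ric⁵(X,Y) - Ric¹(X,Y) - 'R³(AY,AX)` equals `Ric(X,Y) + (n-1) η(X) η(Y)`, which removes
the terms of `2R⁵` without `A`. -/
theorem IsKahler.two_smul_H5_apply (h : IsKahler D A) (hη : SmoothOneForm η)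
    (hn : (finrank ℝ E : ℝ) - 1 ≠ 0)
    (hX : SmoothNear X x) (hY : SmoothNear Y x) (hZ : SmoothNear Z x) :
    (2 : ℝ) • H5 (quarterSymmetric D A η) A X Y Z x =
      (2 : ℝ) • curv D X Y Z x
        + (1 / ((finrank ℝ E : ℝ) - 1)) • (ric (curv D) X Y x • Z x - ric (curv D) Y Z x • X x)
        + ric (curv D) Y (A.app X) x • A x (Z x) - ric (curv D) Z (A.app Y) x • A x (X x) := by
  have hA (W : VField E M) : A.app W x = A x (W x) := rfl
  have hAX := h.smoothNear_app hX
  have hAY := h.smoothNear_app hY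
  have hAZ := h.smoothNear_app hZ
  have hR := (eq_inv_smul_iff₀ two_ne_zero).2 (h.two_smul_curv5_apply hη hX hY hZ)
  have hRic {Y Z : VField E M} (hY : SmoothNear Y x) (hZ : SmoothNear Z x) :=
    (eq_inv_mul_iff_mul_eq₀ two_ne_zero).2 (h.two_mul_ric_curv5 hη hY hZ)
  obtain ⟨m, hm⟩ : ∃ m : ℝ, (finrank ℝ E : ℝ) = m + 1 := ⟨finrank ℝ E - 1, by ring⟩
  simp only [H5, Pi.add_apply, Pi.sub_apply, Pi.smul_apply', Pi.smul_apply, hR, hRic hX hY,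
    hRic hY hZ, h.ric_curv1 hη hX hY, h.ric_curv1 hη hY hZ, h.ric_curv1 hη hY hAX,
    h.ric_curv3 hη hZ hAY, h.primeTrace_curv3 hη hAY hAX, h.primeTrace_curv3 hη hAZ hAY,
    h.primeTrace_curv3 hη hAZ hX,
    hA, h.almostHermitian.sq, map_neg, neg_apply]
  rw [hm, add_sub_cancel_right] at hn ⊢
  match_scalars <;> field_simp <;> ring

end Main

end QuarterSymmetric

theorem mainTheorem3 {E : Type*} [NormedAddCommGroup E] [NormedSpace ℝ E] [FiniteDimensional ℝ E]
    {M : Type*} [TopologicalSpace M] [T2Space M] [ChartedSpace E M] [IsManifold 𝓘(ℝ, E) ∞ M]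
    [RiemannianBundle (fun x : M ↦ TangentSpace 𝓘(ℝ, E) x)]
    [IsContMDiffRiemannianBundle 𝓘(ℝ, E) ∞ E (fun x : M ↦ TangentSpace 𝓘(ℝ, E) x)]
    (k : ℕ) (hk : 2 ≤ k) (hdim : Module.finrank ℝ E = 2 * k)
    (D : QuarterSymmetric.Connection E M) (A : QuarterSymmetric.EndField E M)
    (hKahler : QuarterSymmetric.IsKahler D A)
    (η : QuarterSymmetric.OneForm E M) (hη : QuarterSymmetric.SmoothOneForm η)
    (D₁ : QuarterSymmetric.Connection E M) (hD₁ : D₁ = QuarterSymmetric.quarterSymmetric D A η)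
    (X Y Z : QuarterSymmetric.VField E M)
    (hX : QuarterSymmetric.SmoothField X) (hY : QuarterSymmetric.SmoothField Y)
    (hZ : QuarterSymmetric.SmoothField Z) :
    (4 : ℝ) • QuarterSymmetric.H0 D₁ A X Y Z - (2 : ℝ) • QuarterSymmetric.H1 D₁ A X Y Z
        - QuarterSymmetric.H2 D₁ A X Y Z = QuarterSymmetric.weyl D X Y Z ∧
    (2 : ℝ) • QuarterSymmetric.H5 D₁ A X Y Z - QuarterSymmetric.H1 D₁ A X Y Z
        + QuarterSymmetric.H1 D₁ A Y Z X = QuarterSymmetric.weyl D X Z Y := by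
  subst hD₁
  have hn : (finrank ℝ E : ℝ) - 1 ≠ 0 := by
    rw [hdim]
    push_cast
    have : (2 : ℝ) ≤ k := by exact_mod_cast hk
    linarith
  constructor
  · ext x
    have hX := hX.smoothNear x
    have hY := hY.smoothNear x
    have hZ := hZ.smoothNear x
    simp only [QuarterSymmetric.weyl, Pi.sub_apply, Pi.add_apply, Pi.smul_apply, Pi.smul_apply',
      hKahler.four_smul_H0_apply hη hn hX hY hZ, hKahler.H1_apply hη hX hY hZ,
      hKahler.H2_apply hη hX hY hZ]
    module
  · ext x
    have hX := hX.smoothNear x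
    have hY := hY.smoothNear x
    have hZ := hZ.smoothNear x
    have hB := hKahler.leviCivita.bianchi hX hY hZ
    -- Bianchi in the form `R(X,Y)Z + R(Y,Z)X = R(X,Z)Y`.
    rw [QuarterSymmetric.curv_antisymm D Z X, Pi.neg_apply, ← sub_eq_add_neg, sub_eq_zero] at hB
    simp only [QuarterSymmetric.weyl, Pi.sub_apply, Pi.add_apply, Pi.smul_apply, Pi.smul_apply',
      hKahler.two_smul_H5_apply hη hn hX hY hZ, hKahler.H1_apply hη hX hY hZ,
      hKahler.H1_apply hη hY hZ hX, ← hB, hKahler.leviCivita.ric_symm hZ hY]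
    module
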